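/- Let $\mathcal{B}$ be a locally finitely presentable category and let $\mathcal{B}_\omega\subseteq\mathcal{B}$ be its full subcategory of finitely presented objects, that is, of the objects $X$ for which $\mathcal{B}(X,-)$ preserves filtered colimits. For an object $K$ of $\mathcal{B}$, the coslice $K\downarrow\mathcal{B}$ has as objects the arrows $K\to B$ in $\mathcal{B}$ and as morphisms the commutative triangles under $K$; write $(K\downarrow\mathcal{B})_\omega$ for its full subcategory of finitely presented objects. Let $K$ be a finitely presented object of $\mathcal{B}$. Then an object $k:K\to K'$ of $K\downarrow\mathcal{B}$ is finitely presented in $K\downarrow\mathcal{B}$ if and only if $K'$ is finitely presented in $\mathcal{B}$. Consequently there is an equivalence of categories $$(K\downarrow\mathcal{B})_\omega\simeq K\downarrow\mathcal{B}_\omega,$$ where $K\downarrow\mathcal{B}_\omega$ is the coslice of $\mathcal{B}_\omega$ at $K$, and this equivalence is compatible, up to natural isomorphism, with the inclusions of both categories into $K\downarrow\mathcal{B}$. -/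

import Mathlib

open CategoryTheory

universe w v u

/-- The full subcategory of finitely presented objects of a category. -/
abbrev FinPres (B : Type u) [Category.{v} B] : Type u :=
  (ObjectProperty.isFinitelyPresentable.{w} B).FullSubcategory

/-- The inclusion into the coslice of `B` under `K` of the coslice, under `K`, of the full
subcategory of finitely presented objects of `B`: an object `K ⟶ K'` with `K'` finitely presented
is sent to the same arrow seen in `B`, and a commutative triangle to the same triangle. -/
abbrev cosliceInclusion {B : Type u} [Category.{v} B] (K : B)
    (hK : IsFinitelyPresentable.{w} K) :
    Under (⟨K, hK⟩ : FinPres.{w} B) ⥤ Under K :=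
  Under.post (X := (⟨K, hK⟩ : FinPres.{w} B)) (ObjectProperty.isFinitelyPresentable.{w} B).ι

namespace CategoryTheory

open Limits Opposite

variable {C : Type u} [Category.{v} C] {K : C}

/-! Filtered colimits under `K` are computed in `B`. A lift of `K' ⟶ colim D` to a stage in `B`
becomes a map under `K` at a later stage, as `K` is finitely presentable. Conversely, for `D` in
`B`, the map `K ⟶ K' ⟶ colim D` factors through some `D.obj i`; this puts `D`, restricted to `Under
i`, under `K`, and finality of `Under i ⥤ J` keeps the colimit. -/

/-- An object under a finitely presentable object `K` is finitely presentable as soon as its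
underlying object is. -/
lemma Under.isFinitelyPresentable_of_right [IsFinitelyPresentable.{w} K] (X : Under K)
    [IsFinitelyPresentable.{w} X.right] : IsFinitelyPresentable.{w} X := by
  rw [isFinitelyPresentable_iff_preservesFilteredColimitsOfSize]
  refine ⟨fun J _ _ ↦ ⟨fun {D} ↦ ⟨fun {c} hc ↦
    ⟨Types.FilteredColimit.isColimitOf' _ _ (fun f ↦ ?_) (fun j f₁ f₂ h ↦ ?_)⟩⟩⟩⟩
  · have hc' := isColimitOfPreserves (Under.forget K) hc
    change X ⟶ c.pt at f
    obtain ⟨i, p, hp⟩ : ∃ (i : J) (p : X.right ⟶ (D.obj i).right),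
        p ≫ (c.ι.app i).right = f.right :=
      IsFinitelyPresentable.exists_hom_of_isColimit hc' f.right
    obtain ⟨j, a, ha⟩ : ∃ (j : J) (a : i ⟶ j),
        (X.hom ≫ p) ≫ (D.map a).right = (D.obj i).hom ≫ (D.map a).right := by
      obtain ⟨k, a, b, hab⟩ := IsFinitelyPresentable.exists_eq_of_isColimit hc'
        (i := i) (j := i) (X.hom ≫ p) (D.obj i).hom (by
          change (X.hom ≫ p) ≫ (c.ι.app i).right = (D.obj i).hom ≫ (c.ι.app i).right
          rw [Category.assoc, hp, Under.w, Under.w]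
          rfl)
      change (X.hom ≫ p) ≫ (D.map a).right = (D.obj i).hom ≫ (D.map b).right at hab
      -- `a` and `b` may differ, but both carry the structure map of `D.obj i` to that of `D.obj k`.
      exact ⟨k, a, by rw [hab, Under.w, Under.w]⟩
    refine ⟨j, Under.homMk (p ≫ (D.map a).right) ?_, Under.UnderMorphism.ext ?_⟩
    · change X.hom ≫ p ≫ (D.map a).right = (D.obj j).hom
      rw [← Category.assoc, ha, Under.w]
    · change f.right = (p ≫ (D.map a).right) ≫ (c.ι.app j).right
      rw [Category.assoc, ← Under.comp_right, c.w, hp]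
  · have hc' := isColimitOfPreserves (Under.forget K) hc
    change X ⟶ D.obj j at f₁ f₂
    obtain ⟨k, a, ha⟩ := (Types.FilteredColimit.isColimit_eq_iff'
      (isColimitOfPreserves (coyoneda.obj (op X.right)) hc') f₁.right f₂.right).1
        (congrArg CommaMorphism.right h)
    exact ⟨k, a, Under.UnderMorphism.ext ha⟩

/-- If an object under a finitely presentable object `K` is finitely presentable, then so is its
underlying object. -/
lemma Under.isFinitelyPresentable_right [IsFinitelyPresentable.{w} K] (X : Under K)
    [IsFinitelyPresentable.{w} X] : IsFinitelyPresentable.{w} X.right := by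
  rw [isFinitelyPresentable_iff_preservesFilteredColimitsOfSize]
  refine ⟨fun J _ _ ↦ ⟨fun {D} ↦ ⟨fun {c} hc ↦
    ⟨Types.FilteredColimit.isColimitOf' _ _ (fun f ↦ ?_) (fun j f₁ f₂ h ↦ ?_)⟩⟩⟩⟩
  · change X.right ⟶ c.pt at f
    obtain ⟨i, p, hp⟩ := IsFinitelyPresentable.exists_hom_of_isColimit hc (X.hom ≫ f)
    let s : (Functor.const (Under i)).obj K ⟶ Under.forget i ⋙ D :=
      { app a := p ≫ D.map a.hom
        naturality a b φ := by
          change 𝟙 K ≫ p ≫ D.map b.hom = (p ≫ D.map a.hom) ≫ D.map φ.right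
          rw [Category.id_comp, Category.assoc, ← D.map_comp, Under.w] }
    have : IsFinitelyPresentable.{w} (Under.mk X.hom) := ‹IsFinitelyPresentable.{w} X›
    obtain ⟨a, q, -, hq⟩ := IsFinitelyPresentable.exists_hom_of_isColimit_under
      ((Functor.Final.isColimitWhiskerEquiv (Under.forget i) c).symm hc) X.hom s f (fun a ↦ by
        change (p ≫ D.map a.hom) ≫ c.ι.app a.right = X.hom ≫ f
        rw [Category.assoc, c.w, hp])
    exact ⟨a.right, q, hq.symm⟩
  · change X.right ⟶ D.obj j at f₁ f₂
    change f₁ ≫ c.ι.app j = f₂ ≫ c.ι.app j at h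
    -- At this stage `f₁` and `f₂` induce the same map from `K`, so both become morphisms under `K`
    -- for one structure `s`.
    obtain ⟨i, a, ha⟩ : ∃ (i : J) (a : j ⟶ i),
        (X.hom ≫ f₁) ≫ D.map a = (X.hom ≫ f₂) ≫ D.map a :=
      (Types.FilteredColimit.isColimit_eq_iff'
        (isColimitOfPreserves (coyoneda.obj (op K)) hc) (X.hom ≫ f₁) (X.hom ≫ f₂)).1 (by
          change (X.hom ≫ f₁) ≫ c.ι.app j = (X.hom ≫ f₂) ≫ c.ι.app j
          rw [Category.assoc, h, Category.assoc])
    let s : (Functor.const (Under i)).obj K ⟶ Under.forget i ⋙ D :=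
      { app b := (X.hom ≫ f₁) ≫ D.map a ≫ D.map b.hom
        naturality b b' φ := by
          change 𝟙 K ≫ (X.hom ≫ f₁) ≫ D.map a ≫ D.map b'.hom =
            ((X.hom ≫ f₁) ≫ D.map a ≫ D.map b.hom) ≫ D.map φ.right
          simp only [Category.id_comp, Category.assoc, ← D.map_comp, Under.w] }
    have hs (b : Under i) :
        s.app b ≫ c.ι.app b.right = X.hom ≫ f₁ ≫ c.ι.app j := by
      change ((X.hom ≫ f₁) ≫ D.map a ≫ D.map b.hom) ≫ c.ι.app b.right = _
      simp only [Category.assoc, c.w]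
    have : Nonempty (Under i) := IsFiltered.nonempty
    have hc' := Under.isColimitLiftCocone (Under.forget i ⋙ D) s
      (c.whisker (Under.forget i)) (X.hom ≫ f₁ ≫ c.ι.app j) hs
      ((Functor.Final.isColimitWhiskerEquiv (Under.forget i) c).symm hc)
    let i₀ : Under i := Under.mk (𝟙 i)
    let g₁ : X ⟶ (Under.lift (Under.forget i ⋙ D) s).obj i₀ :=
      Under.homMk (f₁ ≫ D.map a) (by
        change X.hom ≫ f₁ ≫ D.map a = (X.hom ≫ f₁) ≫ D.map a ≫ D.map (𝟙 i)
        rw [D.map_id, Category.comp_id, Category.assoc])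
    let g₂ : X ⟶ (Under.lift (Under.forget i ⋙ D) s).obj i₀ :=
      Under.homMk (f₂ ≫ D.map a) (by
        change X.hom ≫ f₂ ≫ D.map a = (X.hom ≫ f₁) ≫ D.map a ≫ D.map (𝟙 i)
        rw [D.map_id, Category.comp_id, ha, Category.assoc])
    obtain ⟨b, φ, hφ⟩ := (Types.FilteredColimit.isColimit_eq_iff'
      (isColimitOfPreserves (coyoneda.obj (op X)) hc') g₁ g₂).1 (by
        apply Under.UnderMorphism.ext
        change (f₁ ≫ D.map a) ≫ c.ι.app i = (f₂ ≫ D.map a) ≫ c.ι.app i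
        rw [Category.assoc, c.w, h, Category.assoc, c.w])
    refine ⟨b.right, a ≫ φ.right, ?_⟩
    have hφ' : (f₁ ≫ D.map a) ≫ D.map φ.right = (f₂ ≫ D.map a) ≫ D.map φ.right :=
      congrArg CommaMorphism.right hφ
    change f₁ ≫ D.map (a ≫ φ.right) = f₂ ≫ D.map (a ≫ φ.right)
    simpa only [D.map_comp, Category.assoc] using hφ'

lemma Under.isFinitelyPresentable_iff_right [IsFinitelyPresentable.{w} K] (X : Under K) :
    IsFinitelyPresentable.{w} X ↔ IsFinitelyPresentable.{w} X.right :=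
  ⟨fun _ ↦ X.isFinitelyPresentable_right, fun _ ↦ X.isFinitelyPresentable_of_right⟩

end CategoryTheory

/-- The coslice inclusion, with values in the finitely presentable objects of the coslice. -/
abbrev cosliceInclusionLift {B : Type u} [Category.{v} B] (K : B)
    (hK : IsFinitelyPresentable.{w} K) :
    Under (⟨K, hK⟩ : FinPres.{w} B) ⥤ FinPres.{w} (Under K) :=
  (ObjectProperty.isFinitelyPresentable.{w} (Under K)).lift (cosliceInclusion K hK)
    fun X ↦ (Under.isFinitelyPresentable_iff_right _).2 X.right.property

instance cosliceInclusionLift_essSurj {B : Type u} [Category.{v} B] (K : B)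
    (hK : IsFinitelyPresentable.{w} K) : (cosliceInclusionLift K hK).EssSurj where
  mem_essImage X :=
    let Y : FinPres.{w} B := ⟨X.obj.right, (Under.isFinitelyPresentable_iff_right _).1 X.property⟩
    ⟨Under.mk (Y := Y) (ObjectProperty.homMk X.obj.hom),
      ⟨(ObjectProperty.isFinitelyPresentable.{w} (Under K)).isoMk (Under.isoMk (Iso.refl _) (Category.comp_id _))⟩⟩

theorem mainTheorem7 {B : Type u} [Category.{v} B] [IsLocallyFinitelyPresentable.{w} B]
    (K : B) (hK : IsFinitelyPresentable.{w} K) :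
    (∀ X : Under K, IsFinitelyPresentable.{w} X ↔ IsFinitelyPresentable.{w} X.right) ∧
      ∃ e : FinPres.{w} (Under K) ≌ Under (⟨K, hK⟩ : FinPres.{w} B),
        Nonempty (e.functor ⋙ cosliceInclusion K hK ≅
          (ObjectProperty.isFinitelyPresentable.{w} (Under K)).ι) := by
  refine ⟨Under.isFinitelyPresentable_iff_right, ?_⟩
  have : (cosliceInclusion K hK).Full :=
    inferInstanceAs (Under.post (X := (⟨K, hK⟩ : FinPres.{w} B)) _).Full
  have : (cosliceInclusion K hK).Faithful :=
    inferInstanceAs (Under.post (X := (⟨K, hK⟩ : FinPres.{w} B)) _).Faithful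
  -- Full faithfulness descends from the composite with the fully faithful `ι`.
  have : (cosliceInclusionLift K hK).IsEquivalence :=
    { full := Functor.Full.of_comp_faithful_iso (ObjectProperty.liftCompιIso _ _ _)
      faithful := Functor.Faithful.of_comp_iso (ObjectProperty.liftCompιIso _ _ _) }
  exact ⟨(cosliceInclusionLift K hK).asEquivalence.symm,
    ⟨Functor.isoWhiskerRight (cosliceInclusionLift K hK).asEquivalence.counitIso
      (ObjectProperty.isFinitelyPresentable.{w} (Under K)).ι⟩⟩
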